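/- Let $\mathcal{L}$ be the real vector space of (almost everywhere classes of) measurable functions $f:(0,\infty)\to\mathbb{R}$ such that $s\mapsto f(s)e^{-sx}$ is Lebesgue integrable on $(0,\infty)$ for every $x>0$, and write $\widehat{f}(x)=\int_0^\infty f(s)e^{-sx}\,ds$ for $x>0$. For each $\alpha\in(0,\infty)$ let $J^\alpha:\mathcal{L}\to\mathcal{L}$ be a linear operator (not assumed to be a convolution) that is continuous for $\|\cdot\|_{L^1(0,T)}$ for every $T>0$, that is, for each $T>0$, $\|J^\alpha f_1-J^\alpha f_2\|_{L^1(0,T)}\to 0$ when $f_1,f_2\in\mathcal{L}$ and $\|f_1-f_2\|_{L^1(0,T)}\to 0$. Suppose: 1. (Identity) $J^1f(t)=\int_0^t f(s)\,ds$ for all $f\in\mathcal{L}$ and almost every $t>0$; 2. (Index law) $J^{\alpha+\beta}=J^\alpha\circ J^\beta$ on $\mathcal{L}$ for all $\alpha,\beta\in(0,\infty)$; 3. (Continuity) for every $x\in(0,\infty)$, the map $\alpha\mapsto\widehat{J^\alpha 1}(x)$ from $(0,\infty)$ to $\mathbb{R}$ is continuous at at least one point (which may depend on $x$). Then, for all $\alpha\in(0,\infty)$,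 $J^\alpha$ is the Riemann-Liouville integral $I^\alpha$ on $\mathcal{L}$: for every $f\in\mathcal{L}$ and almost every $t>0$, the function $s\mapsto(t-s)^{\alpha-1}f(s)$ is integrable on $(0,t)$ and $$J^\alpha f(t)=I^\alpha f(t)=\frac{1}{\Gamma(\alpha)}\int_0^t (t-s)^{\alpha-1}f(s)\,ds.$$ -/

import Mathlib

open MeasureTheory Set

/-- Lebesgue measure on the half-line `(0,∞)`. -/
noncomputable abbrev halfLine : Measure ℝ := volume.restrict (Ioi (0 : ℝ))

/-- The space `𝓛` of Laplace transformable functions `(0,∞) → ℝ`, as usual modulo equality almost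
everywhere: measurable functions `f` such that `s ↦ f s * exp (-s x)` is Lebesgue integrable on
`(0,∞)` for every `x > 0`. -/
noncomputable def laplaceSpace : Submodule ℝ (ℝ →ₘ[halfLine] ℝ) where
  carrier := {f | ∀ x : ℝ, 0 < x → Integrable (fun s => f s * Real.exp (-(s * x))) halfLine}
  zero_mem' := by
    intro x _
    refine (integrable_zero ℝ ℝ halfLine).congr ?_
    filter_upwards [AEEqFun.coeFn_zero (μ := halfLine) (α := ℝ) (β := ℝ)] with s hs
    simp [hs]
  add_mem' := by
    intro f g hf hg x hx
    refine ((hf x hx).add (hg x hx)).congr ?_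
    filter_upwards [AEEqFun.coeFn_add f g] with s hs
    simp [hs, add_mul]
  smul_mem' := by
    intro c f hf x hx
    refine ((hf x hx).const_mul c).congr ?_
    filter_upwards [AEEqFun.coeFn_smul c f] with s hs
    simp [hs, mul_assoc]

/-- Elements of `𝓛` are used as functions, through a representative of the class. -/
noncomputable instance : CoeFun laplaceSpace (fun _ => ℝ → ℝ) := ⟨fun f => ⇑f.1⟩

theorem one_mem_laplaceSpace : (1 : ℝ →ₘ[halfLine] ℝ) ∈ laplaceSpace := by
  intro x hx
  have h : Integrable (fun s : ℝ => Real.exp (-x * s)) halfLine :=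
    exp_neg_integrableOn_Ioi 0 hx
  refine h.congr ?_
  filter_upwards [AEEqFun.coeFn_one (μ := halfLine) (α := ℝ) (β := ℝ)] with s hs
  simp [hs, mul_comm]

/-- The constant function `1` as an element of `𝓛`. -/
noncomputable def laplaceOne : laplaceSpace := ⟨1, one_mem_laplaceSpace⟩

/-- The Laplace transform `x ↦ ∫_0^∞ f(s) exp (-s x) ds`. -/
noncomputable def laplaceTransform (f : laplaceSpace) (x : ℝ) : ℝ :=
  ∫ s in Ioi (0 : ℝ), f s * Real.exp (-(s * x))

/-- The `L¹(0,T)` seminorm on `𝓛` (elements of `𝓛` are integrable on `(0,T)`). -/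
noncomputable def l1Seminorm (T : ℝ) (f : laplaceSpace) : ℝ :=
  ∫ s in Ioo (0 : ℝ) T, |f s|

/-- The Riemann-Liouville integral of order `α > 0` with left origin `0`. -/
noncomputable def riemannLiouville (α : ℝ) (f : ℝ → ℝ) (t : ℝ) : ℝ :=
  (1 / Real.Gamma α) * ∫ s in Ioo (0 : ℝ) t, (t - s) ^ (α - 1) * f s

/-! # Uniqueness of the Riemann-Liouville fractional integral on Laplace transformable functions -/

/-! Write `I` for `J 1` and `m_α(x) = x · (J^α 1)^(x)`. By the index law `J^α` commutes with `I`, so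
on a polynomial, a combination of the `I^n 1`, it multiplies the Laplace transform by `m_α`. The
formal kernel of `J^α` is the derivative of `J^α 1`, which need not be a function; but `I ∘ J^α`
should be convolution with `J^α 1` itself. On polynomials this follows from injectivity of the
transform (Lerch). It extends to all of `𝓛` because polynomials are dense in `L¹(0,T)`, `I ∘ J^α =
J^(1+α)` is continuous there, and so is the convolution (Young). This is
`integral_comp_ae_eq_halfLineConvolution`; hence `m_α` is a multiplier on all of `𝓛`.

The index law now reads `m_(α+β) = m_α m_β`, with `m_1 = 1/x`. For fixed `x`, one point of
continuity in `α` forces `m_α(x) = x^(-α)` (`eq_one_of_multiplicative_of_continuousAt`). This is the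
transform of the Riemann-Liouville kernel, and Lerch's theorem concludes. -/

/-! ### Laplace transform and convolution on the half-line -/

/-- Functions on `(0,∞)` whose product with `exp (-s x)` is integrable for every `x > 0`. -/
def IsLaplaceTransformable (f : ℝ → ℝ) : Prop :=
  ∀ x : ℝ, 0 < x → Integrable (fun s => f s * Real.exp (-(s * x))) halfLine

/-- The Laplace transform of a function on `(0,∞)`. -/
noncomputable def laplaceIntegral (f : ℝ → ℝ) (x : ℝ) : ℝ :=
  ∫ s in Ioi (0 : ℝ), f s * Real.exp (-(s * x))

/-- The convolution product of real functions on `(0,∞)`. -/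
noncomputable def halfLineConvolution (f g : ℝ → ℝ) : ℝ → ℝ :=
  posConvolution f g (ContinuousLinearMap.mul ℝ ℝ)

theorem halfLineConvolution_apply (f g : ℝ → ℝ) {t : ℝ} (ht : 0 < t) :
    halfLineConvolution f g t = ∫ s in Ioo (0 : ℝ) t, f s * g (t - s) := by
  rw [halfLineConvolution, posConvolution, indicator_of_mem (mem_Ioi.2 ht),
    intervalIntegral.integral_of_le ht.le, integral_Ioc_eq_integral_Ioo]
  rfl

/-- The weight is a character, `e^(-tx) = e^(-sx) e^(-(t-s)x)`; this reduces statements on Laplace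
transforms to `L¹` ones. -/
theorem halfLineConvolution_mul_exp (f g : ℝ → ℝ) (x t : ℝ) :
    halfLineConvolution (fun s => f s * Real.exp (-(s * x)))
      (fun s => g s * Real.exp (-(s * x))) t =
    halfLineConvolution f g t * Real.exp (-(t * x)) := by
  by_cases ht : 0 < t
  · rw [halfLineConvolution_apply _ _ ht, halfLineConvolution_apply _ _ ht,
      ← integral_mul_const]
    refine integral_congr_ae (Filter.Eventually.of_forall fun s => ?_)
    have h : Real.exp (-(t * x)) = Real.exp (-(s * x)) * Real.exp (-((t - s) * x)) := by
      rw [← Real.exp_add]; ring_nf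
    simp only [h]
    ring
  · have ht' : t ∉ Ioi (0 : ℝ) := ht
    simp [halfLineConvolution, posConvolution, ht']

theorem integrable_halfLineConvolution {f g : ℝ → ℝ} (hf : Integrable f halfLine)
    (hg : Integrable g halfLine) : Integrable (halfLineConvolution f g) :=
  integrable_posConvolution (μ := volume) (ν := volume) hf hg _

theorem integral_halfLineConvolution {f g : ℝ → ℝ} (hf : Integrable f halfLine)
    (hg : Integrable g halfLine) :
    ∫ t in Ioi (0 : ℝ), halfLineConvolution f g t =
      (∫ t in Ioi (0 : ℝ), f t) * ∫ t in Ioi (0 : ℝ), g t := by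
  have h := integral_posConvolution (μ := volume) (ν := volume) hf hg
    (ContinuousLinearMap.mul ℝ ℝ)
  rw [ContinuousLinearMap.mul_apply'] at h
  rw [← h]
  refine setIntegral_congr_fun measurableSet_Ioi fun t ht => ?_
  rw [halfLineConvolution, posConvolution, indicator_of_mem ht]

namespace IsLaplaceTransformable

variable {f g : ℝ → ℝ}

theorem of_mem (f : laplaceSpace) : IsLaplaceTransformable f := f.2

theorem sub (hf : IsLaplaceTransformable f) (hg : IsLaplaceTransformable g) :
    IsLaplaceTransformable (fun s => f s - g s) := fun x hx => by
  simp only [sub_mul]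
  exact (hf x hx).sub (hg x hx)

theorem convolution (hf : IsLaplaceTransformable f) (hg : IsLaplaceTransformable g) :
    IsLaplaceTransformable (halfLineConvolution f g) := fun x hx => by
  have h := (integrable_halfLineConvolution (hf x hx) (hg x hx)).restrict (s := Ioi (0 : ℝ))
  exact h.congr (Filter.Eventually.of_forall fun t => halfLineConvolution_mul_exp f g x t)

theorem integrableOn_Ioo (hf : IsLaplaceTransformable f) (T : ℝ) :
    IntegrableOn f (Ioo 0 T) := by
  have h1 : IntegrableOn (fun s => f s * Real.exp (-(s * 1))) (Ioo 0 T) :=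
    IntegrableOn.mono_set (hf 1 one_pos) Ioo_subset_Ioi_self
  have h2 : IntegrableOn (fun s => Real.exp (s * 1) * (f s * Real.exp (-(s * 1)))) (Ioo 0 T) := by
    refine h1.bdd_mul (c := Real.exp T) (by fun_prop) ?_
    filter_upwards [ae_restrict_mem measurableSet_Ioo] with s hs
    rw [Real.norm_eq_abs, Real.abs_exp, mul_one]
    exact Real.exp_le_exp.2 hs.2.le
  refine h2.congr (Filter.Eventually.of_forall fun s => ?_)
  simp only
  rw [mul_left_comm, ← Real.exp_add]
  simp

end IsLaplaceTransformable

theorem laplaceIntegral_halfLineConvolution {f g : ℝ → ℝ} (hf : IsLaplaceTransformable f)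
    (hg : IsLaplaceTransformable g) {x : ℝ} (hx : 0 < x) :
    laplaceIntegral (halfLineConvolution f g) x = laplaceIntegral f x * laplaceIntegral g x := by
  rw [laplaceIntegral, laplaceIntegral, laplaceIntegral,
    ← integral_halfLineConvolution (hf x hx) (hg x hx)]
  simp only [halfLineConvolution_mul_exp]

theorem laplaceIntegral_sub {f g : ℝ → ℝ} (hf : IsLaplaceTransformable f)
    (hg : IsLaplaceTransformable g) {x : ℝ} (hx : 0 < x) :
    laplaceIntegral (fun s => f s - g s) x = laplaceIntegral f x - laplaceIntegral g x := by
  simp only [laplaceIntegral, sub_mul]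
  exact integral_sub (hf x hx) (hg x hx)

theorem laplaceIntegral_add {f g : ℝ → ℝ} (hf : IsLaplaceTransformable f)
    (hg : IsLaplaceTransformable g) {x : ℝ} (hx : 0 < x) :
    laplaceIntegral (fun s => f s + g s) x = laplaceIntegral f x + laplaceIntegral g x := by
  simp only [laplaceIntegral, add_mul]
  exact integral_add (hf x hx) (hg x hx)

theorem laplaceIntegral_congr_ae {f g : ℝ → ℝ} (h : f =ᵐ[halfLine] g) (x : ℝ) :
    laplaceIntegral f x = laplaceIntegral g x := by
  refine integral_congr_ae ?_
  filter_upwards [h] with s hs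
  rw [hs]

/-- Young's inequality on `(0,T)`: for `t < T` the convolution sees only values on `(0,T)`, so both
functions may be truncated there and the integral of a convolution over the half-line applies. -/
theorem setIntegral_abs_halfLineConvolution_le {f g : ℝ → ℝ} (hf : IsLaplaceTransformable f)
    (hg : IsLaplaceTransformable g) (T : ℝ) :
    ∫ t in Ioo (0 : ℝ) T, |halfLineConvolution f g t| ≤
      (∫ t in Ioo (0 : ℝ) T, |f t|) * ∫ t in Ioo (0 : ℝ) T, |g t| := by
  set F : ℝ → ℝ := (Ioo (0 : ℝ) T).indicator fun s => |f s|
  set G : ℝ → ℝ := (Ioo (0 : ℝ) T).indicator fun s => |g s|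
  have hF : Integrable F halfLine :=
    ((integrable_indicator_iff measurableSet_Ioo).2 (hf.integrableOn_Ioo T).abs).restrict
  have hG : Integrable G halfLine :=
    ((integrable_indicator_iff measurableSet_Ioo).2 (hg.integrableOn_Ioo T).abs).restrict
  have hres : ∀ h : ℝ → ℝ, ∫ t in Ioi (0 : ℝ), (Ioo (0 : ℝ) T).indicator h t =
      ∫ t in Ioo (0 : ℝ) T, h t := fun h => by
    rw [setIntegral_indicator measurableSet_Ioo, inter_eq_right.2 Ioo_subset_Ioi_self]
  have hF0 : ∀ s, 0 ≤ F s := fun s => indicator_nonneg (fun _ _ => abs_nonneg _) s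
  have hG0 : ∀ s, 0 ≤ G s := fun s => indicator_nonneg (fun _ _ => abs_nonneg _) s
  have hint := integrable_halfLineConvolution hF hG
  have hpt : ∀ t ∈ Ioo (0 : ℝ) T, |halfLineConvolution f g t| ≤ halfLineConvolution F G t := by
    intro t ht
    rw [halfLineConvolution_apply _ _ ht.1, halfLineConvolution_apply _ _ ht.1]
    refine (abs_integral_le_integral_abs).trans (le_of_eq ?_)
    refine setIntegral_congr_fun measurableSet_Ioo fun s hs => ?_
    have h1 : s ∈ Ioo (0 : ℝ) T := ⟨hs.1, hs.2.trans ht.2⟩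
    have h2 : t - s ∈ Ioo (0 : ℝ) T := ⟨sub_pos.2 hs.2, by linarith [hs.1, ht.2]⟩
    simp only [F, G, indicator_of_mem h1, indicator_of_mem h2, abs_mul]
  calc ∫ t in Ioo (0 : ℝ) T, |halfLineConvolution f g t|
      ≤ ∫ t in Ioo (0 : ℝ) T, halfLineConvolution F G t :=
        setIntegral_mono_on ((hf.convolution hg).integrableOn_Ioo T).abs
          hint.integrableOn measurableSet_Ioo hpt
    _ ≤ ∫ t in Ioi (0 : ℝ), halfLineConvolution F G t := by
        refine setIntegral_mono_set hint.integrableOn ?_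
          (Filter.Eventually.of_forall Ioo_subset_Ioi_self)
        filter_upwards [ae_restrict_mem measurableSet_Ioi] with t ht
        rw [halfLineConvolution_apply _ _ ht]
        exact integral_nonneg fun s => mul_nonneg (hF0 _) (hG0 _)
    _ = _ := by
        rw [integral_halfLineConvolution hF hG, hres, hres]

/-- The integrand of the convolution is integrable for almost every endpoint. -/
theorem ae_integrableOn_halfLineConvolution_integrand {f g : ℝ → ℝ}
    (hf : IsLaplaceTransformable f) (hg : IsLaplaceTransformable g) :
    ∀ᵐ t ∂halfLine, IntegrableOn (fun s => f s * g (t - s)) (Ioo (0 : ℝ) t) := by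
  have hf1 := (integrable_indicator_iff measurableSet_Ioi).2
    (show IntegrableOn (fun s => f s * Real.exp (-(s * 1))) (Ioi (0 : ℝ)) volume from hf 1 one_pos)
  have hg1 := (integrable_indicator_iff measurableSet_Ioi).2
    (show IntegrableOn (fun s => g s * Real.exp (-(s * 1))) (Ioi (0 : ℝ)) volume from hg 1 one_pos)
  filter_upwards [ae_restrict_of_ae
    (hf1.ae_convolution_exists (ContinuousLinearMap.mul ℝ ℝ) hg1)] with t ht
  have h : IntegrableOn _ (Ioo (0 : ℝ) t) := (Integrable.integrableOn ht).const_mul (Real.exp t)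
  refine h.congr_fun (fun s hs => ?_) measurableSet_Ioo
  have h1 : s ∈ Ioi (0 : ℝ) := hs.1
  have h2 : t - s ∈ Ioi (0 : ℝ) := sub_pos.2 hs.2
  simp only [indicator_of_mem h1, indicator_of_mem h2, ContinuousLinearMap.mul_apply', mul_one]
  have h3 : Real.exp t * (Real.exp (-s) * Real.exp (-(t - s))) = 1 := by
    rw [← Real.exp_add, ← Real.exp_add]
    ring_nf
    exact Real.exp_zero
  linear_combination (f s * g (t - s)) * h3

/-! ### The multiplicative functional equation -/

/-- A multiplicative function on `(0,∞)` with value `1` at `1` which is continuous at one point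
is constant. -/
theorem eq_one_of_multiplicative_of_continuousAt {ψ : ℝ → ℝ} {a₀ : ℝ}
    (hmul : ∀ a b, 0 < a → 0 < b → ψ (a + b) = ψ a * ψ b) (hone : ψ 1 = 1) (ha₀ : 0 < a₀)
    (hc : ContinuousAt ψ a₀) {a : ℝ} (ha : 0 < a) : ψ a = 1 := by
  -- Each value is a square, which makes the root extraction in `hrat` unambiguous.
  have hnn : ∀ b, 0 < b → 0 ≤ ψ b := fun b hb => by
    rw [← add_halves b, hmul _ _ (half_pos hb) (half_pos hb)]
    exact mul_self_nonneg _
  have hpow : ∀ b, 0 < b → ∀ n : ℕ, ψ ((n + 1 : ℕ) * b) = ψ b ^ (n + 1) := fun b hb n => by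
    induction n with
    | zero => simp
    | succ n ih =>
      rw [pow_succ, ← ih, ← hmul _ _ (by positivity) hb]
      congr 1
      push_cast
      ring
  have hrat : ∀ q : ℚ, 0 < q → ψ q = 1 := fun q hq => by
    obtain ⟨n, hn⟩ := Nat.exists_eq_succ_of_ne_zero q.den_nz
    obtain ⟨m, hm⟩ := Nat.exists_eq_succ_of_ne_zero
      (show q.num.toNat ≠ 0 by have := Rat.num_pos.2 hq; omega)
    have hq' : (0 : ℝ) < q := by exact_mod_cast hq
    have h1 := hpow q hq' n
    have h2 := hpow 1 one_pos m
    have h3 : ((n + 1 : ℕ) : ℝ) * q = ((m + 1 : ℕ) : ℝ) * 1 := by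
      rw [← Nat.succ_eq_add_one n, ← Nat.succ_eq_add_one m, ← hn, ← hm, mul_one]
      have h4 : ((q.num.toNat : ℤ) : ℚ) = q.den * q := by
        rw [Int.toNat_of_nonneg (Rat.num_pos.2 hq).le, Rat.den_mul_eq_num]
      exact_mod_cast h4.symm
    rw [h3, h2, hone, one_pow] at h1
    exact (pow_eq_one_iff_of_nonneg (hnn _ hq') (Nat.succ_ne_zero n)).1 h1.symm
  have key : ∀ b, 0 < b → ψ b = ψ a₀ := fun b hb => by
    by_contra hne
    obtain ⟨δ, hδ, h⟩ := Metric.continuousAt_iff.1 hc _ (abs_pos.2 (sub_ne_zero.2 hne))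
    -- A rational translation moves `b` close to `a₀` without changing `ψ b`.
    obtain ⟨q, hq1, hq2⟩ := exists_rat_btwn (show a₀ - b < a₀ - b + δ by linarith)
    have hbq : ψ (b + q) = ψ b := by
      rcases lt_trichotomy q 0 with hq | hq | hq
      · have h1 := hmul (b + q) ((-q : ℚ) : ℝ) (by linarith)
          (by exact_mod_cast neg_pos.2 hq)
        rw [hrat _ (neg_pos.2 hq), mul_one] at h1
        rw [← h1]
        push_cast
        ring_nf
      · simp [hq]
      · rw [hmul _ _ hb (by exact_mod_cast hq), hrat q hq, mul_one]
    have h2 := h (x := b + q) (by rw [Real.dist_eq, abs_lt]; constructor <;> linarith)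
    rw [hbq, Real.dist_eq] at h2
    exact lt_irrefl _ h2
  rw [key a ha, ← key 1 one_pos, hone]

/-! ### Lerch's theorem -/

/-- The `n`-th monomial contributes the transform at `n + 1`; the extra factor `e^(-s)` keeps `n =
0` inside the range `x > 0`. -/
theorem integral_polynomial_exp_neg_mul {f : ℝ → ℝ} (hf : IsLaplaceTransformable f)
    (h0 : ∀ x, 0 < x → laplaceIntegral f x = 0) (p : Polynomial ℝ) :
    Integrable (fun s => p.eval (Real.exp (-s)) * (f s * Real.exp (-(s * 1)))) halfLine ∧
      ∫ s in Ioi (0 : ℝ), p.eval (Real.exp (-s)) * (f s * Real.exp (-(s * 1))) = 0 := by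
  have hrew : ∀ s : ℝ, p.eval (Real.exp (-s)) * (f s * Real.exp (-(s * 1))) =
      ∑ n ∈ Finset.range (p.natDegree + 1),
        p.coeff n * (f s * Real.exp (-(s * ((n : ℝ) + 1)))) := fun s => by
    rw [Polynomial.eval_eq_sum_range, Finset.sum_mul]
    refine Finset.sum_congr rfl fun n _ => ?_
    have h : Real.exp (-(s * ((n : ℝ) + 1))) = Real.exp (-s) ^ n * Real.exp (-(s * 1)) := by
      rw [← Real.exp_nat_mul, ← Real.exp_add]
      ring_nf
    rw [h]
    ring
  have hint : ∀ n ∈ Finset.range (p.natDegree + 1),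
      Integrable (fun s => p.coeff n * (f s * Real.exp (-(s * ((n : ℝ) + 1))))) halfLine :=
    fun n _ => (hf _ (by positivity)).const_mul _
  simp only [hrew]
  refine ⟨integrable_finsetSum _ hint, ?_⟩
  rw [integral_finsetSum _ hint]
  refine Finset.sum_eq_zero fun n _ => ?_
  rw [integral_const_mul, show ∫ s in Ioi (0 : ℝ), f s * Real.exp (-(s * ((n : ℝ) + 1))) = 0 from
    h0 _ (by positivity), mul_zero]

/-- Under `u = e^(-s)`, the point `u = 0` is `s = ∞`, where `ψ` vanishes. The default `Real.log 0 =
0` agrees with this limit since `ψ 0 = 0`. -/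
theorem continuous_comp_neg_log {ψ : ℝ → ℝ} (hψ : Continuous ψ) (hs : HasCompactSupport ψ)
    (h0 : tsupport ψ ⊆ Ioi 0) : Continuous fun u => ψ (-Real.log u) := by
  refine continuous_iff_continuousAt.2 fun u => ?_
  by_cases hu : u = 0
  · subst hu
    have hz : ψ 0 = 0 := by
      by_contra h
      exact lt_irrefl (0 : ℝ) (h0 (subset_tsupport ψ h))
    have hlim : Filter.Tendsto (fun u => ψ (-Real.log u)) (nhdsWithin 0 {0}ᶜ) (nhds 0) := by
      have h1 := hs.is_zero_at_infty
      refine h1.comp (Filter.Tendsto.mono_right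
        (Filter.tendsto_neg_atBot_atTop.comp Real.tendsto_log_nhdsNE_zero) ?_)
      exact atTop_le_cocompact
    rw [continuousAt_iff_punctured_nhds]
    simpa [hz] using hlim
  · exact hψ.continuousAt.comp (Real.continuousAt_log hu).neg

/-- Lerch's theorem: the Laplace transform is injective. -/
theorem ae_eq_zero_of_laplaceIntegral_eq_zero {f : ℝ → ℝ} (hf : IsLaplaceTransformable f)
    (h0 : ∀ x, 0 < x → laplaceIntegral f x = 0) : f =ᵐ[halfLine] 0 := by
  set h : ℝ → ℝ := fun s => f s * Real.exp (-(s * 1)) with hdef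
  have hh : Integrable h halfLine := hf 1 one_pos
  have hh' : IntegrableOn h (Ioi 0) volume := hh
  have key : ∀ᵐ s, s ∈ Ioi (0 : ℝ) → h s = 0 := by
    refine isOpen_Ioi.ae_eq_zero_of_integral_contDiff_smul_eq_zero hh'.locallyIntegrableOn ?_
    intro ψ hψ hψs hψ0
    have hset : ∫ s, ψ s • h s = ∫ s in Ioi (0 : ℝ), ψ s * h s := by
      rw [setIntegral_eq_integral_of_forall_compl_eq_zero]
      · rfl
      · intro s hs
        rw [image_eq_zero_of_notMem_tsupport fun hs' => hs (hψ0 hs'), zero_mul]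
    rw [hset]
    obtain ⟨C, hC⟩ := hψs.exists_bound_of_continuous hψ.continuous
    have hψh : Integrable (fun s => ψ s * h s) halfLine :=
      hh.bdd_mul hψ.continuous.aestronglyMeasurable (Filter.Eventually.of_forall hC)
    by_contra hne
    have hpos := abs_pos.2 hne
    set A := ∫ s in Ioi (0 : ℝ), |h s|
    have hA : 0 ≤ A := integral_nonneg fun _ => abs_nonneg _
    obtain ⟨ε, hε, hεA⟩ : ∃ ε > 0, ε * A < |∫ s in Ioi (0 : ℝ), ψ s * h s| := by
      refine ⟨|∫ s in Ioi (0 : ℝ), ψ s * h s| / (A + 1), by positivity, ?_⟩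
      rw [div_mul_eq_mul_div, div_lt_iff₀ (by positivity)]
      exact mul_lt_mul_of_pos_left (lt_add_one A) hpos
    -- Weierstrass in the variable `u = e^(-s)`, which ranges in `[0,1]`.
    obtain ⟨p, hp⟩ := exists_polynomial_near_of_continuousOn 0 1 _
      (continuous_comp_neg_log hψ.continuous hψs hψ0).continuousOn ε hε
    obtain ⟨hpi, hp0⟩ := integral_polynomial_exp_neg_mul hf h0 p
    refine hεA.not_ge ?_
    calc |∫ s in Ioi (0 : ℝ), ψ s * h s|
        = |∫ s in Ioi (0 : ℝ), (ψ s * h s - p.eval (Real.exp (-s)) * h s)| := by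
          rw [integral_sub hψh hpi, hp0, sub_zero]
      _ ≤ ∫ s in Ioi (0 : ℝ), |ψ s * h s - p.eval (Real.exp (-s)) * h s| :=
          abs_integral_le_integral_abs
      _ ≤ ∫ s in Ioi (0 : ℝ), ε * |h s| := by
          refine setIntegral_mono_on (hψh.sub hpi).abs (hh.abs.const_mul ε)
            measurableSet_Ioi fun s hs => ?_
          rw [← sub_mul, abs_mul]
          refine mul_le_mul_of_nonneg_right ?_ (abs_nonneg _)
          have h1 := hp (Real.exp (-s)) ⟨(Real.exp_pos _).le,
            Real.exp_le_one_iff.2 (neg_nonpos.2 (mem_Ioi.1 hs).le)⟩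
          rw [Real.log_exp, neg_neg, abs_sub_comm] at h1
          exact h1.le
      _ = ε * A := integral_const_mul _ _
  filter_upwards [(ae_restrict_iff' measurableSet_Ioi).2 key] with s hs
  exact (mul_eq_zero.1 hs).resolve_right (Real.exp_ne_zero _)

theorem ae_eq_of_laplaceIntegral_eq {f g : ℝ → ℝ} (hf : IsLaplaceTransformable f)
    (hg : IsLaplaceTransformable g)
    (h : ∀ x, 0 < x → laplaceIntegral f x = laplaceIntegral g x) : f =ᵐ[halfLine] g := by
  filter_upwards [ae_eq_zero_of_laplaceIntegral_eq_zero (hf.sub hg) fun x hx => by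
    rw [laplaceIntegral_sub hf hg hx, h x hx, sub_self]] with s hs
  exact sub_eq_zero.1 hs

/-! ### Density of polynomials -/

/-- Polynomials are dense in `L¹(0,T)`. -/
theorem exists_polynomial_integral_abs_sub_lt {f : ℝ → ℝ} {T : ℝ}
    (hf : IntegrableOn f (Ioo 0 T)) {ε : ℝ} (hT : 0 < T) (hε : 0 < ε) :
    ∃ p : Polynomial ℝ, ∫ s in Ioo (0 : ℝ) T, |f s - p.eval s| < ε := by
  obtain ⟨g, -, hfg, hg, hgi⟩ :=
    Integrable.exists_hasCompactSupport_integral_sub_le (μ := volume.restrict (Ioo 0 T)) hf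
      (half_pos hε)
  obtain ⟨p, hp⟩ := exists_polynomial_near_of_continuousOn 0 T g hg.continuousOn (ε / (4 * T))
    (by positivity)
  have hpi : IntegrableOn (fun s => p.eval s) (Ioo 0 T) :=
    (p.continuous.integrableOn_Icc (a := 0) (b := T)).mono_set Ioo_subset_Icc_self
  refine ⟨p, ?_⟩
  calc ∫ s in Ioo (0 : ℝ) T, |f s - p.eval s|
      ≤ ∫ s in Ioo (0 : ℝ) T, (‖f s - g s‖ + ε / (4 * T)) := by
        refine setIntegral_mono_on (hf.sub hpi).abs ((hf.sub hgi).norm.add (integrable_const _))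
          measurableSet_Ioo fun s hs => ?_
        have h1 := hp s (Ioo_subset_Icc_self hs)
        rw [abs_sub_comm] at h1
        exact (abs_sub_le _ (g s) _).trans (add_le_add le_rfl h1.le)
    _ ≤ ε / 2 + T * (ε / (4 * T)) := by
        have hn : IntegrableOn (fun s => ‖f s - g s‖) (Ioo 0 T) := (hf.sub hgi).norm
        rw [integral_add hn (integrable_const _)]
        refine add_le_add hfg (le_of_eq ?_)
        simp [hT.le]
    _ < ε := by
        have h1 : T * (ε / (4 * T)) = ε / 4 := by field_simp
        rw [h1]
        linarith

/-! ### The Riemann-Liouville kernel -/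

/-- The Riemann-Liouville kernel. -/
noncomputable def riemannLiouvilleKernel (α t : ℝ) : ℝ := t ^ (α - 1) / Real.Gamma α

theorem riemannLiouvilleKernel_one (t : ℝ) : riemannLiouvilleKernel 1 t = 1 := by
  simp [riemannLiouvilleKernel]

theorem laplaceIntegral_riemannLiouvilleKernel {α x : ℝ} (hα : 0 < α) (hx : 0 < x) :
    laplaceIntegral (riemannLiouvilleKernel α) x = x ^ (-α) := by
  have hΓ := (Real.Gamma_pos_of_pos hα).ne'
  have h := Real.integral_rpow_mul_exp_neg_mul_Ioi hα hx
  have h1 : laplaceIntegral (riemannLiouvilleKernel α) x =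
      (∫ t in Ioi (0 : ℝ), t ^ (α - 1) * Real.exp (-(x * t))) / Real.Gamma α := by
    rw [← integral_div]
    refine integral_congr_ae (Filter.Eventually.of_forall fun t => ?_)
    simp only [riemannLiouvilleKernel, mul_comm t x]
    ring
  rw [h1, h, mul_div_cancel_right₀ _ hΓ, one_div, Real.inv_rpow hx.le, Real.rpow_neg hx.le]

theorem isLaplaceTransformable_riemannLiouvilleKernel {α : ℝ} (hα : 0 < α) :
    IsLaplaceTransformable (riemannLiouvilleKernel α) := fun x hx => by
  -- A non-integrable function has Bochner integral `0` by convention, so the nonzero value of the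
  -- transform gives integrability.
  refine Integrable.of_integral_ne_zero ?_
  rw [show (∫ s in Ioi (0 : ℝ), riemannLiouvilleKernel α s * Real.exp (-(s * x))) = x ^ (-α) from
    laplaceIntegral_riemannLiouvilleKernel hα hx]
  exact (Real.rpow_pos_of_pos hx _).ne'

/-! ### Laplace transform of classes in `𝓛` -/

theorem laplaceTransform_eq (f : laplaceSpace) (x : ℝ) :
    laplaceTransform f x = laplaceIntegral f x := rfl

theorem coeFn_add (f g : laplaceSpace) :
    (fun s => (f + g) s) =ᵐ[halfLine] fun s => f s + g s := AEEqFun.coeFn_add f.1 g.1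

theorem coeFn_sub (f g : laplaceSpace) :
    (fun s => (f - g) s) =ᵐ[halfLine] fun s => f s - g s := AEEqFun.coeFn_sub f.1 g.1

theorem coeFn_smul (c : ℝ) (f : laplaceSpace) :
    (fun s => (c • f) s) =ᵐ[halfLine] fun s => c * f s := AEEqFun.coeFn_smul c f.1

theorem laplaceTransform_add (f g : laplaceSpace) {x : ℝ} (hx : 0 < x) :
    laplaceTransform (f + g) x = laplaceTransform f x + laplaceTransform g x := by
  rw [laplaceTransform_eq, laplaceIntegral_congr_ae (coeFn_add f g),
    laplaceIntegral_add (.of_mem f) (.of_mem g) hx]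
  rfl

theorem laplaceTransform_sub (f g : laplaceSpace) {x : ℝ} (hx : 0 < x) :
    laplaceTransform (f - g) x = laplaceTransform f x - laplaceTransform g x := by
  rw [laplaceTransform_eq, laplaceIntegral_congr_ae (coeFn_sub f g),
    laplaceIntegral_sub (.of_mem f) (.of_mem g) hx]
  rfl

theorem laplaceTransform_smul (c : ℝ) (f : laplaceSpace) (x : ℝ) :
    laplaceTransform (c • f) x = c * laplaceTransform f x := by
  rw [laplaceTransform_eq, laplaceIntegral_congr_ae (coeFn_smul c f)]
  simp only [laplaceIntegral, mul_assoc, integral_const_mul]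
  rfl

theorem laplaceTransform_laplaceOne {x : ℝ} (hx : 0 < x) :
    laplaceTransform laplaceOne x = x⁻¹ := by
  have h : (fun s => laplaceOne s) =ᵐ[halfLine] riemannLiouvilleKernel 1 := by
    filter_upwards [AEEqFun.coeFn_one (μ := halfLine) (α := ℝ) (β := ℝ)] with s hs
    rw [riemannLiouvilleKernel_one]
    exact hs
  rw [laplaceTransform_eq, laplaceIntegral_congr_ae h,
    laplaceIntegral_riemannLiouvilleKernel one_pos hx, Real.rpow_neg_one]

/-! ### Operators commuting with integration -/

section Operators

variable {I A : laplaceSpace →ₗ[ℝ] laplaceSpace}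

theorem laplaceTransform_integral
    (hI : ∀ f : laplaceSpace, ∀ᵐ t ∂halfLine, I f t = ∫ s in Ioo (0 : ℝ) t, f s)
    (f : laplaceSpace) {x : ℝ} (hx : 0 < x) :
    laplaceTransform (I f) x = x⁻¹ * laplaceTransform f x := by
  have h : (fun s => I f s) =ᵐ[halfLine] halfLineConvolution f (riemannLiouvilleKernel 1) := by
    filter_upwards [hI f, ae_restrict_mem measurableSet_Ioi] with t ht ht0
    rw [ht, halfLineConvolution_apply _ _ ht0]
    simp only [riemannLiouvilleKernel_one, mul_one]
  rw [laplaceTransform_eq, laplaceIntegral_congr_ae h,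
    laplaceIntegral_halfLineConvolution (.of_mem f)
      (isLaplaceTransformable_riemannLiouvilleKernel one_pos) hx,
    laplaceIntegral_riemannLiouvilleKernel one_pos hx, Real.rpow_neg_one, mul_comm]
  rfl

theorem laplaceTransform_integral_pow
    (hI : ∀ f : laplaceSpace, ∀ᵐ t ∂halfLine, I f t = ∫ s in Ioo (0 : ℝ) t, f s)
    (f : laplaceSpace) {x : ℝ} (hx : 0 < x) (n : ℕ) :
    laplaceTransform ((I ^ n) f) x = x⁻¹ ^ n * laplaceTransform f x := by
  induction n with
  | zero => simp
  | succ n ih =>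
    rw [pow_succ' I, Module.End.mul_apply, laplaceTransform_integral hI _ hx, ih]
    ring

theorem integral_pow_laplaceOne_ae_eq
    (hI : ∀ f : laplaceSpace, ∀ᵐ t ∂halfLine, I f t = ∫ s in Ioo (0 : ℝ) t, f s) (n : ℕ) :
    (fun s => ((I ^ n) laplaceOne) s) =ᵐ[halfLine] fun s => s ^ n / n.factorial := by
  have hn : (0 : ℝ) < n + 1 := by positivity
  have h : (fun s => ((I ^ n) laplaceOne) s) =ᵐ[halfLine] riemannLiouvilleKernel (n + 1) := by
    refine ae_eq_of_laplaceIntegral_eq (.of_mem _)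
      (isLaplaceTransformable_riemannLiouvilleKernel hn) fun x hx => ?_
    rw [← laplaceTransform_eq, laplaceTransform_integral_pow hI _ hx,
      laplaceTransform_laplaceOne hx, laplaceIntegral_riemannLiouvilleKernel hn hx,
      Real.rpow_neg hx.le, ← Nat.cast_succ, Real.rpow_natCast, ← inv_pow, pow_succ]
  filter_upwards [h] with s hs
  rw [hs, riemannLiouvilleKernel, add_sub_cancel_right, Real.rpow_natCast,
    Real.Gamma_nat_eq_factorial]

/-- Every polynomial belongs to `𝓛`, and an operator which commutes with integration acts on it as
a multiplier of the Laplace transform. -/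
theorem exists_ae_eq_polynomial_laplaceTransform
    (hI : ∀ f : laplaceSpace, ∀ᵐ t ∂halfLine, I f t = ∫ s in Ioo (0 : ℝ) t, f s)
    (hcomm : ∀ f, A (I f) = I (A f)) (p : Polynomial ℝ) :
    ∃ f : laplaceSpace, (fun s => f s) =ᵐ[halfLine] (fun s => p.eval s) ∧
      ∀ x : ℝ, 0 < x → laplaceTransform (A f) x =
        x * laplaceTransform (A laplaceOne) x * laplaceTransform f x := by
  induction p using Polynomial.induction_on' with
  | add p q hp hq =>
    obtain ⟨f, hf, hf'⟩ := hp
    obtain ⟨g, hg, hg'⟩ := hq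
    refine ⟨f + g, ?_, fun x hx => ?_⟩
    · filter_upwards [coeFn_add f g, hf, hg] with s h1 h2 h3
      rw [h1, h2, h3, Polynomial.eval_add]
    · rw [map_add, laplaceTransform_add _ _ hx, laplaceTransform_add _ _ hx, hf' x hx, hg' x hx]
      ring
  | monomial n a =>
    refine ⟨(a * n.factorial) • (I ^ n) laplaceOne, ?_, fun x hx => ?_⟩
    · filter_upwards [coeFn_smul (a * n.factorial) ((I ^ n) laplaceOne),
        integral_pow_laplaceOne_ae_eq hI n] with s h1 h2
      rw [h1, h2, Polynomial.eval_monomial]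
      have := Nat.cast_ne_zero (R := ℝ).2 n.factorial_ne_zero
      field_simp
    · have h : A ((I ^ n) laplaceOne) = (I ^ n) (A laplaceOne) := by
        induction n with
        | zero => simp
        | succ n ih => rw [pow_succ', Module.End.mul_apply, hcomm, ih, Module.End.mul_apply]
      rw [map_smul, laplaceTransform_smul, laplaceTransform_smul, h,
        laplaceTransform_integral_pow hI _ hx, laplaceTransform_integral_pow hI _ hx,
        laplaceTransform_laplaceOne hx]
      field_simp

theorem integral_comp_ae_eq_of_laplaceTransform
    (hI : ∀ f : laplaceSpace, ∀ᵐ t ∂halfLine, I f t = ∫ s in Ioo (0 : ℝ) t, f s)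
    {f : laplaceSpace} (hf : ∀ x : ℝ, 0 < x → laplaceTransform (A f) x =
        x * laplaceTransform (A laplaceOne) x * laplaceTransform f x) :
    (fun s => I (A f) s) =ᵐ[halfLine] halfLineConvolution (A laplaceOne) f := by
  refine ae_eq_of_laplaceIntegral_eq (.of_mem _)
    (.convolution (.of_mem _) (.of_mem _)) fun x hx => ?_
  rw [← laplaceTransform_eq, laplaceTransform_integral hI _ hx, hf x hx,
    laplaceIntegral_halfLineConvolution (.of_mem _) (.of_mem _) hx, ← laplaceTransform_eq,
    ← laplaceTransform_eq]
  field_simp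

/-- The integrands need not be integrable for every `t`, so linearity is asserted almost everywhere
and read off from transforms. -/
theorem halfLineConvolution_sub (g f h : laplaceSpace) :
    halfLineConvolution g (fun s => (f - h) s) =ᵐ[halfLine]
      fun s => halfLineConvolution g f s - halfLineConvolution g h s := by
  have hgf : IsLaplaceTransformable (halfLineConvolution g f) :=
    .convolution (.of_mem _) (.of_mem _)
  have hgh : IsLaplaceTransformable (halfLineConvolution g h) :=
    .convolution (.of_mem _) (.of_mem _)
  refine ae_eq_of_laplaceIntegral_eq (.convolution (.of_mem _) (.of_mem _)) (hgf.sub hgh)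
    fun x hx => ?_
  rw [laplaceIntegral_sub hgf hgh hx, laplaceIntegral_halfLineConvolution (.of_mem _) (.of_mem _) hx,
    laplaceIntegral_halfLineConvolution (.of_mem _) (.of_mem _) hx,
    laplaceIntegral_halfLineConvolution (.of_mem _) (.of_mem _) hx, ← laplaceTransform_eq (f - h),
    laplaceTransform_sub _ _ hx, mul_sub]
  rfl

theorem ae_eq_zero_of_setIntegral_abs_eq_zero {f : ℝ → ℝ} (hf : IsLaplaceTransformable f)
    (h : ∀ T : ℝ, 0 < T → ∫ s in Ioo (0 : ℝ) T, |f s| = 0) : f =ᵐ[halfLine] 0 := by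
  have h1 : ∀ n : ℕ, ∀ᵐ s, s ∈ Ioo (0 : ℝ) (n + 1) → f s = 0 := fun n => by
    have h2 := (integral_eq_zero_iff_of_nonneg (fun s => abs_nonneg (f s))
      (hf.integrableOn_Ioo _).abs).1 (h (n + 1) (by positivity))
    filter_upwards [(ae_restrict_iff' measurableSet_Ioo).1 h2] with s hs hs'
    exact abs_eq_zero.1 (hs hs')
  filter_upwards [ae_restrict_of_ae (ae_all_iff.2 h1), ae_restrict_mem measurableSet_Ioi]
    with s hs hs0
  obtain ⟨n, hn⟩ := exists_nat_gt s
  exact hs n ⟨hs0, by linarith⟩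

/-- If `A` commutes with integration `I` and `I ∘ A` is continuous for the seminorms of `L¹(0,T)`,
then `I ∘ A` is the convolution with `A 1`. -/
theorem integral_comp_ae_eq_halfLineConvolution
    (hI : ∀ f : laplaceSpace, ∀ᵐ t ∂halfLine, I f t = ∫ s in Ioo (0 : ℝ) t, f s)
    (hcomm : ∀ f, A (I f) = I (A f))
    (hcont : ∀ T : ℝ, 0 < T → ∀ ε : ℝ, 0 < ε → ∃ δ : ℝ, 0 < δ ∧
      ∀ f : laplaceSpace, l1Seminorm T f < δ → l1Seminorm T (I (A f)) < ε)
    (f : laplaceSpace) :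
    (fun s => I (A f) s) =ᵐ[halfLine] halfLineConvolution (A laplaceOne) f := by
  have hD : IsLaplaceTransformable
      (fun s => I (A f) s - halfLineConvolution (A laplaceOne) f s) :=
    .sub (.of_mem _) (.convolution (.of_mem _) (.of_mem _))
  suffices h : (fun s => I (A f) s - halfLineConvolution (A laplaceOne) f s) =ᵐ[halfLine] 0 by
    filter_upwards [h] with s hs
    exact sub_eq_zero.1 hs
  refine ae_eq_zero_of_setIntegral_abs_eq_zero hD fun T hT => ?_
  refine le_antisymm (le_of_forall_pos_lt_add fun ε hε => ?_)
    (integral_nonneg fun _ => abs_nonneg _)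
  rw [zero_add]
  obtain ⟨δ, hδ, hδ'⟩ := hcont T hT (ε / 2) (half_pos hε)
  set M := l1Seminorm T (A laplaceOne)
  have hM : 0 ≤ M := integral_nonneg fun _ => abs_nonneg _
  -- Closeness `δ` controls `I ∘ A`, and the second bound controls the convolution; `M + 1` avoids
  -- dividing by zero.
  obtain ⟨p, hp⟩ := exists_polynomial_integral_abs_sub_lt
    ((IsLaplaceTransformable.of_mem f).integrableOn_Ioo T) hT
    (lt_min hδ (show 0 < ε / (2 * (M + 1)) by positivity))
  obtain ⟨q, hq, hq'⟩ := exists_ae_eq_polynomial_laplaceTransform hI hcomm p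
  have hIq := integral_comp_ae_eq_of_laplaceTransform hI hq'
  have hsub : ∀ᵐ s ∂halfLine, (f - q) s = f s - p.eval s := by
    filter_upwards [coeFn_sub f q, hq] with s h1 h2
    rw [h1, h2]
  have hle : volume.restrict (Ioo (0 : ℝ) T) ≤ halfLine :=
    Measure.restrict_mono Ioo_subset_Ioi_self le_rfl
  have hnorm : l1Seminorm T (f - q) < min δ (ε / (2 * (M + 1))) := by
    refine lt_of_eq_of_lt (integral_congr_ae ?_) hp
    filter_upwards [ae_mono hle hsub] with s hs
    rw [hs]
  have h1 := hδ' _ (hnorm.trans_le (min_le_left _ _))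
  have h2 := setIntegral_abs_halfLineConvolution_le (.of_mem (A laplaceOne)) (.of_mem (f - q)) T
  have h3 : M * l1Seminorm T (f - q) ≤ ε / 2 := by
    have h4 := hnorm.le.trans (min_le_right _ _)
    calc M * l1Seminorm T (f - q) ≤ (M + 1) * (ε / (2 * (M + 1))) :=
          mul_le_mul (by linarith) h4 (integral_nonneg fun _ => abs_nonneg _) (by linarith)
      _ = ε / 2 := by field_simp
  have hconv : IsLaplaceTransformable (halfLineConvolution (A laplaceOne) (fun s => (f - q) s)) :=
    .convolution (.of_mem _) (.of_mem _)
  have hIA := (IsLaplaceTransformable.of_mem (I (A (f - q)))).integrableOn_Ioo T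
  have hle2 : ∫ s in Ioo (0 : ℝ) T, |I (A f) s - halfLineConvolution (A laplaceOne) f s| ≤
      ∫ s in Ioo (0 : ℝ) T, (|I (A (f - q)) s| +
        |halfLineConvolution (A laplaceOne) (fun s => (f - q) s) s|) := by
    refine integral_mono_ae (hD.integrableOn_Ioo T).abs
      (hIA.abs.add (hconv.integrableOn_Ioo T).abs) ?_
    have hlin : (fun s => I (A (f - q)) s) =ᵐ[halfLine] fun s => I (A f) s - I (A q) s := by
      rw [map_sub, map_sub]
      exact coeFn_sub _ _
    filter_upwards [ae_mono hle hlin, ae_mono hle hIq,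
      ae_mono hle (halfLineConvolution_sub (A laplaceOne) f q)] with s e1 e2 e3
    rw [e1, e3, e2]
    refine le_trans (le_of_eq ?_) (abs_sub _ _)
    congr 1
    ring
  rw [integral_add hIA.abs (hconv.integrableOn_Ioo T).abs] at hle2
  have h5 : ∫ s in Ioo (0 : ℝ) T, |I (A (f - q)) s| < ε / 2 := h1
  have h6 := h2.trans h3
  linarith

theorem laplaceTransform_of_commute_integral
    (hI : ∀ f : laplaceSpace, ∀ᵐ t ∂halfLine, I f t = ∫ s in Ioo (0 : ℝ) t, f s)
    (hcomm : ∀ f, A (I f) = I (A f))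
    (hcont : ∀ T : ℝ, 0 < T → ∀ ε : ℝ, 0 < ε → ∃ δ : ℝ, 0 < δ ∧
      ∀ f : laplaceSpace, l1Seminorm T f < δ → l1Seminorm T (I (A f)) < ε)
    (f : laplaceSpace) {x : ℝ} (hx : 0 < x) :
    laplaceTransform (A f) x =
      x * laplaceTransform (A laplaceOne) x * laplaceTransform f x := by
  have h := laplaceIntegral_congr_ae
    (integral_comp_ae_eq_halfLineConvolution hI hcomm hcont f) x
  rw [← laplaceTransform_eq, laplaceTransform_integral hI _ hx,
    laplaceIntegral_halfLineConvolution (.of_mem _) (.of_mem _) hx, ← laplaceTransform_eq,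
    ← laplaceTransform_eq] at h
  rw [mul_assoc, ← h, mul_inv_cancel_left₀ hx.ne']

end Operators

/-! ### Identification of the multiplier -/

theorem mainTheorem7
    (J : ℝ → (laplaceSpace →ₗ[ℝ] laplaceSpace))
    (hcont : ∀ α : ℝ, 0 < α → ∀ T : ℝ, 0 < T → ∀ ε : ℝ, 0 < ε → ∃ δ : ℝ, 0 < δ ∧
      ∀ f₁ f₂ : laplaceSpace, l1Seminorm T (f₁ - f₂) < δ →
        l1Seminorm T (J α f₁ - J α f₂) < ε)
    (hone : ∀ f : laplaceSpace, ∀ᵐ t ∂halfLine, J 1 f t = ∫ s in Ioo (0 : ℝ) t, f s)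
    (hindex : ∀ α β : ℝ, 0 < α → 0 < β → J (α + β) = J α ∘ₗ J β)
    (hpoint : ∀ x : ℝ, 0 < x → ∃ α₀ : ℝ, 0 < α₀ ∧
      ContinuousAt (fun α : ℝ => laplaceTransform (J α laplaceOne) x) α₀) :
    ∀ α : ℝ, 0 < α → ∀ f : laplaceSpace, ∀ᵐ t ∂halfLine,
      IntegrableOn (fun s => (t - s) ^ (α - 1) * f s) (Ioo (0 : ℝ) t) ∧
        J α f t = riemannLiouville α f t := by
  have hmult : ∀ α : ℝ, 0 < α → ∀ f : laplaceSpace, ∀ x : ℝ, 0 < x →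
      laplaceTransform (J α f) x =
        x * laplaceTransform (J α laplaceOne) x * laplaceTransform f x := by
    intro α hα f x hx
    refine laplaceTransform_of_commute_integral hone (fun f => ?_) (fun T hT ε hε => ?_) f hx
    · rw [← LinearMap.comp_apply, ← LinearMap.comp_apply, ← hindex α 1 hα one_pos,
        ← hindex 1 α one_pos hα, add_comm]
    -- The composite `J 1 ∘ J α` is `J (1 + α)`, so its continuity is that of order `1 + α`.
    · obtain ⟨δ, hδ, h⟩ := hcont (1 + α) (by positivity) T hT ε hε
      refine ⟨δ, hδ, fun f hf => ?_⟩
      have h1 := h f 0 (by rwa [sub_zero])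
      rwa [map_zero, sub_zero, hindex 1 α one_pos hα] at h1
  have hpow : ∀ α : ℝ, 0 < α → ∀ x : ℝ, 0 < x →
      x * laplaceTransform (J α laplaceOne) x = x ^ (-α) := by
    intro α hα x hx
    obtain ⟨α₀, hα₀, hc⟩ := hpoint x hx
    -- Normalising by `x ^ α` turns `m_1 = 1/x` into the value `1` at `1`.
    have h := eq_one_of_multiplicative_of_continuousAt
      (ψ := fun α => x ^ α * (x * laplaceTransform (J α laplaceOne) x)) (a₀ := α₀)
      (fun a b ha hb => by
        rw [hindex a b ha hb, LinearMap.comp_apply, hmult a ha _ x hx, Real.rpow_add hx]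
        ring)
      (by
        rw [laplaceTransform_integral hone _ hx, laplaceTransform_laplaceOne hx, Real.rpow_one]
        field_simp)
      hα₀ ((Real.continuous_const_rpow hx.ne').continuousAt.mul (hc.const_mul x)) hα
    rw [Real.rpow_neg hx.le]
    exact eq_inv_of_mul_eq_one_right h
  intro α hα f
  have hk := isLaplaceTransformable_riemannLiouvilleKernel hα
  have hJ : (fun s => J α f s) =ᵐ[halfLine] halfLineConvolution f (riemannLiouvilleKernel α) := by
    refine ae_eq_of_laplaceIntegral_eq (.of_mem _) (.convolution (.of_mem _) hk) fun x hx => ?_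
    rw [← laplaceTransform_eq, hmult α hα f x hx, hpow α hα x hx,
      laplaceIntegral_halfLineConvolution (.of_mem _) hk hx,
      laplaceIntegral_riemannLiouvilleKernel hα hx, mul_comm]
    rfl
  have hΓ := (Real.Gamma_pos_of_pos hα).ne'
  have hrew : ∀ t s : ℝ, (t - s) ^ (α - 1) * f s =
      Real.Gamma α * (f s * riemannLiouvilleKernel α (t - s)) := fun t s => by
    rw [riemannLiouvilleKernel]
    field_simp
  filter_upwards [hJ, ae_integrableOn_halfLineConvolution_integrand (.of_mem f) hk,
    ae_restrict_mem measurableSet_Ioi] with t h1 h2 ht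
  refine ⟨?_, ?_⟩
  · simp only [hrew]
    exact Integrable.const_mul h2 _
  · rw [h1, halfLineConvolution_apply _ _ ht, riemannLiouville]
    simp only [hrew]
    rw [integral_const_mul, ← mul_assoc, one_div_mul_cancel hΓ, one_mul]
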